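/- Let $p>3$ be a prime and let $d\neq 0$ be a rational number whose numerator (in lowest terms) is not divisible by $p$. For an integer $a$ put $q_p(a)=\frac{a^{p-1}-1}{p}$. For rational numbers $a,b$ write $a\equiv b\pmod{p^4}$ if $a-b=p^4c$ for some rational number $c$ whose denominator is not divisible by $p$. Then \begin{align*} \sum_{k=0}^{p-1}\left(1+(4-d)k^2+\frac{8+d}{2}k\right)\frac{\binom{2k}{k}}{d^k}&\equiv \left(\frac{16}{d}\right)^{p-1}\left(p(2p-1)(1-4p\,q_p(2))-10p^3q_p(2)^2\right)\pmod{p^4},\\ \sum_{k=0}^{p-1}\left(1+\frac{27-4d}{6}k^2+\frac{27+2d}{6}k\right)\frac{\binom{3k}{k}}{d^k}&\equiv \left(-\frac{27}{d}\right)^{p-1}p\left((2p-1)(1-3p\,q_p(3))-6p^2q_p(3)^2\right)\pmod{p^4},\\ \sum_{k=0}^{p-1}\left(1+\frac{16-d}{3}k^2+\frac{32+d}{6}k\right)\frac{\binom{4k}{2k}}{d^k}&\equiv \left(-\frac{64}{d}\right)^{p-1}p\left((2p-1)(1-6p\,q_p(2))-21p^2q_p(2)^2\right)\pmod{p^4},\\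 \sum_{k=0}^{p-1}\left(1+\frac{108-d}{15}k^2+\frac{216+d}{30}k\right)\frac{\binom{3k}{k}\binom{6k}{3k}}{d^k\binom{2k}{k}}&\equiv \left(-\frac{432}{d}\right)^{p-1}p\Bigl((2p-1)(1-4p\,q_p(2)-3p\,q_p(3))\\ &\qquad-2p^2\bigl(5q_p(2)^2+6q_p(2)q_p(3)+3q_p(3)^2\bigr)\Bigr)\pmod{p^4}. \end{align*} -/

import Mathlib

/-- The Fermat quotient `q_p(a) = (a ^ (p - 1) - 1) / p`, as a rational number. -/
def fermatQuotient (p : ℕ) (a : ℤ) : ℚ :=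
  ((a : ℚ) ^ (p - 1) - 1) / p

/-- Congruence of rational numbers modulo `p ^ n` (for a prime `p`): the difference lies in
`p ^ n ℤ_(p)`, where `ℤ_(p)` is the ring of rationals whose denominator is not divisible
by `p`. -/
def RatModPow (p n : ℕ) (a b : ℚ) : Prop :=
  ∃ c : ℚ, ¬ p ∣ c.den ∧ a - b = (p : ℚ) ^ n * c

/-!
Each summand is `(r k - d * k * (2 * k - 1)) * M k / d ^ k` up to the constant `r 0 = M 1`, where
`M` is the quotient of factorials and `(k + 1) * (2 * k + 1) * M (k + 1) = r k * M k`. So the sum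
telescopes to `p * (2 * p - 1) * (M p / M 1) * d ^ (1 - p)`. The number `(n * p)! / (n! * p ! ^ n)`
is a product of binomial coefficients that are `1` modulo `p ^ 3` by Wolstenholme's congruence, and
therefore so is `M p / M 1`, the powers of `p !` cancelling. It remains to compare `2 * p - 1` with
the right-hand side modulo `p ^ 3`: as `a ^ (p - 1) = 1 + p * q_p(a)`, the power of `16`, `27`, `64`
or `432` is undone by a binomial series in `p * q_p(a)`, truncated after the quadratic term.
-/

section Wolstenholme

open Polynomial

theorem pow_dvd_eval_sub_sum_coeff {R : Type*} [CommRing R] (f : R[X]) (x : R) (n : ℕ) :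
    x ^ n ∣ f.eval x - ∑ i ∈ Finset.range n, f.coeff i * x ^ i := by
  have h : X ^ n ∣ f - ∑ i ∈ Finset.range n, C (f.coeff i) * X ^ i := by
    rw [X_pow_dvd_iff]
    intro d hd
    simp [finsetSum_coeff, coeff_X_pow, hd]
  simpa [eval_finsetSum] using eval_dvd (x := x) h

theorem pow_three_dvd_eval_mul_sub_eval_zero {R : Type*} [CommRing R] [IsDomain R] {p : R}
    (hp : p ≠ 0) {f : R[X]} (hsymm : f.eval (-p) = f.eval 0) (hcoeff : p ∣ f.coeff 2) (x : R) :
    p ^ 3 ∣ f.eval (p * x) - f.eval 0 := by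
  obtain ⟨u, hu⟩ := pow_dvd_eval_sub_sum_coeff f (-p) 3
  obtain ⟨v, hv⟩ := pow_dvd_eval_sub_sum_coeff f (p * x) 3
  obtain ⟨b, hb⟩ := hcoeff
  have h0 : f.eval 0 = f.coeff 0 := (coeff_zero_eq_eval_zero f).symm
  simp only [Finset.sum_range_succ, Finset.sum_range_zero, hsymm, h0, hb] at hu hv ⊢
  have hcoeff_one : f.coeff 1 = p ^ 2 * (b - u) := mul_left_cancel₀ hp <| by
    linear_combination hu
  exact ⟨(b - u) * x + b * x ^ 2 + x ^ 3 * v, by linear_combination hv + p * x * hcoeff_one⟩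

theorem ascPochhammer_zmod_card (p : ℕ) [hp : Fact p.Prime] :
    ascPochhammer (ZMod p) p = X ^ p - X := by
  have hmonic := monic_ascPochhammer (ZMod p) p
  have hmonic' : (X ^ p - X : (ZMod p)[X]).Monic :=
    monic_X_pow_sub (degree_X_le.trans_lt (by exact_mod_cast hp.out.one_lt))
  have hdegree : (ascPochhammer (ZMod p) p).degree = p := by
    rw [degree_eq_natDegree hmonic.ne_zero, ascPochhammer_natDegree]
  refine eq_of_degree_le_of_eval_finset_eq Finset.univ ?_ ?_ ?_ fun x _ => ?_
  · simp [hdegree, ZMod.card]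
  · rw [hdegree, degree_eq_natDegree hmonic'.ne_zero,
      FiniteField.X_pow_card_sub_X_natDegree_eq _ hp.out.one_lt]
  · rw [hmonic.leadingCoeff, hmonic'.leadingCoeff]
  · have h := ascPochhammer_eval_neg_coe_nat_of_lt (R := ZMod p) (ZMod.val_lt (-x))
    rw [ZMod.natCast_rightInverse, neg_neg] at h
    simp [h]

/-- The polynomial `(X + 1)(X + 2)⋯(X + n)`, whose value at `k * p` for `n = p - 1` is
`(p - 1)!` times the binomial coefficient of Wolstenholme's congruence. -/
noncomputable def shiftedAscPochhammer (n : ℕ) : ℤ[X] :=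
  (ascPochhammer ℤ n).comp (X + 1)

theorem shiftedAscPochhammer_eval_neg_succ {n : ℕ} (hn : Even n) :
    (shiftedAscPochhammer n).eval (-(n + 1 : ℤ)) = (shiftedAscPochhammer n).eval 0 := by
  have h := ascPochhammer_eval_neg_eq_descPochhammer ℤ (n : ℤ) n
  rw [descPochhammer_eval_eq_ascPochhammer, hn.neg_one_pow, one_mul, sub_self] at h
  simpa [shiftedAscPochhammer, eval_comp] using h

theorem shiftedAscPochhammer_eval_natCast (n k : ℕ) :
    (shiftedAscPochhammer n).eval (k : ℤ) = n.factorial * (k + n).choose n := by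
  rw [shiftedAscPochhammer, eval_comp, eval_add, eval_X, eval_one, ← Nat.cast_succ,
    ascPochhammer_nat_eq_natCast_ascFactorial, Nat.ascFactorial_eq_factorial_mul_choose,
    Nat.cast_mul]

theorem dvd_coeff_two_shiftedAscPochhammer {p : ℕ} (hp : p.Prime) (hp3 : 3 < p) :
    (p : ℤ) ∣ (shiftedAscPochhammer (p - 1)).coeff 2 := by
  have := Fact.mk hp
  have hX : X * shiftedAscPochhammer (p - 1) = ascPochhammer ℤ p := by
    rw [shiftedAscPochhammer, ← ascPochhammer_succ_left, Nat.sub_add_cancel hp.one_le]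
  rw [← coeff_X_mul, hX, ← ZMod.intCast_zmod_eq_zero_iff_dvd, ← eq_intCast (Int.castRingHom _),
    ← coeff_map, ascPochhammer_map, ascPochhammer_zmod_card]
  simp [coeff_X_pow, coeff_X, hp3.ne]

theorem choose_mul_add_pred_modEq_one {p : ℕ} (hp : p.Prime) (hp3 : 3 < p) (n : ℕ) :
    ((n * p + (p - 1)).choose (p - 1) : ℤ) ≡ 1 [ZMOD p ^ 3] := by
  have hsymm : (shiftedAscPochhammer (p - 1)).eval (-(p : ℤ)) =
      (shiftedAscPochhammer (p - 1)).eval 0 := by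
    simpa [hp.one_le] using shiftedAscPochhammer_eval_neg_succ (hp.even_sub_one (by lia))
  have hdvd := pow_three_dvd_eval_mul_sub_eval_zero (by exact_mod_cast hp.ne_zero) hsymm
    (dvd_coeff_two_shiftedAscPochhammer hp hp3) n
  have hval (k : ℕ) := shiftedAscPochhammer_eval_natCast (p - 1) k
  rw [← Nat.cast_mul, mul_comm p, hval, ← Nat.cast_zero, hval, zero_add, Nat.choose_self,
    ← mul_sub, Nat.cast_one] at hdvd
  have hcoprime : IsCoprime ((p : ℤ) ^ 3) (p - 1).factorial :=
    (Nat.isCoprime_iff_coprime.mpr (hp.coprime_factorial_of_lt (by lia))).pow_left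
  exact (Int.modEq_iff_dvd.mpr (hcoprime.dvd_of_dvd_mul_left hdvd)).symm

theorem uniformBell_prime_modEq_one {p : ℕ} (hp : p.Prime) (hp3 : 3 < p) (n : ℕ) :
    (n.uniformBell p : ℤ) ≡ 1 [ZMOD p ^ 3] := by
  induction n with
  | zero => simp [Nat.uniformBell_zero_left, Int.ModEq.refl]
  | succ n ih =>
    rw [Nat.uniformBell_succ_left, Nat.add_sub_assoc hp.one_le, Nat.cast_mul]
    exact (choose_mul_add_pred_modEq_one hp hp3 n).mul ih

end Wolstenholme

section Congruence

open Rat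

variable {p n : ℕ}

theorem ratModPow_intCast_of_modEq (hp : p ≠ 1) {a b : ℤ} (h : a ≡ b [ZMOD p ^ n]) :
    RatModPow p n a b := by
  obtain ⟨c, hc⟩ := h.symm.dvd
  exact ⟨c, by simpa using hp, by exact_mod_cast hc⟩

theorem RatModPow.natCast_mul {a b : ℚ} (h : RatModPow p n a b) :
    RatModPow p (n + 1) (p * a) (p * b) := by
  obtain ⟨c, hc, habc⟩ := h
  exact ⟨c, hc, by rw [← mul_sub, habc]; ring⟩

variable [Fact p.Prime] {a b c : ℚ}

theorem ratModPow_iff_padicValuation_le :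
    RatModPow p n a b ↔ padicValuation p (a - b) ≤ padicValuation p p ^ n := by
  have hp : (p : ℚ) ^ n ≠ 0 := pow_ne_zero n (Nat.cast_ne_zero.mpr (NeZero.ne p))
  have hpos : 0 < padicValuation p p ^ n := by
    rw [← map_pow]
    exact (Valuation.pos_iff _).mpr hp
  simp only [RatModPow, ← padicValuation_le_one_iff]
  constructor
  · rintro ⟨c, hc, habc⟩
    rw [habc, map_mul, map_pow]
    exact mul_le_of_le_one_right' hc
  · intro h
    refine ⟨(a - b) / p ^ n, ?_, (mul_div_cancel₀ _ hp).symm⟩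
    rwa [map_div₀, map_pow, div_le_one₀ hpos]

theorem RatModPow.symm (h : RatModPow p n a b) : RatModPow p n b a := by
  rw [ratModPow_iff_padicValuation_le] at h ⊢
  rwa [Valuation.map_sub_swap]

theorem RatModPow.trans (hab : RatModPow p n a b) (hbc : RatModPow p n b c) :
    RatModPow p n a c := by
  rw [ratModPow_iff_padicValuation_le] at hab hbc ⊢
  simpa using Valuation.map_add_le _ hab hbc

theorem RatModPow.mul_left (hc : padicValuation p c ≤ 1) (h : RatModPow p n a b) :
    RatModPow p n (c * a) (c * b) := by
  rw [ratModPow_iff_padicValuation_le] at h ⊢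
  rw [← mul_sub, map_mul]
  exact mul_le_of_le_one_of_le hc h

theorem RatModPow.padicValuation_eq_one (hn : n ≠ 0) (h : RatModPow p n a 1) :
    padicValuation p a = 1 := by
  have hp : padicValuation p p < 1 := by
    rw [← Int.cast_natCast, padicValuation_cast, Int.padicValuation_lt_one_iff]
  rw [ratModPow_iff_padicValuation_le] at h
  rw [← map_one (padicValuation p)]
  refine Valuation.map_eq_of_sub_lt _ (h.trans_lt ?_)
  rw [map_one]
  exact pow_lt_one₀ zero_le hp hn

theorem RatModPow.mul_congr_one (hn : n ≠ 0) (ha : RatModPow p n a 1) (hb : RatModPow p n b 1) :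
    RatModPow p n (a * b) 1 := by
  have hab := hb.mul_left (ha.padicValuation_eq_one hn).le
  rw [mul_one] at hab
  exact hab.trans ha

theorem RatModPow.div_congr_one (hn : n ≠ 0) (ha : RatModPow p n a 1) (hb : RatModPow p n b 1) :
    RatModPow p n (a / b) 1 := by
  have hvb := hb.padicValuation_eq_one hn
  have hb0 : b ≠ 0 := by
    rintro rfl
    simp at hvb
  have hab := (ha.trans hb.symm).mul_left (c := b⁻¹) (by simp [hvb])
  rwa [inv_mul_cancel₀ hb0, ← div_eq_inv_mul] at hab

theorem padicValuation_inv_le_one {d : ℚ} (hpd : ¬ (p : ℤ) ∣ d.num) :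
    padicValuation p d⁻¹ ≤ 1 := by
  have hd : d ≠ 0 := by
    rintro rfl
    simp at hpd
  rwa [padicValuation_le_one_iff, den_inv_of_ne_zero hd, ← Int.natCast_dvd]

end Congruence

section FactorialRatio

open scoped Nat

/-- The ratio `∏ (s_i * k)! / ∏ (t_j * k)!` as a sequence in `k`; the binomial-type weights of
the sums below all have this form, with the multisets `s` and `t` having equal sums. -/
def factorialRatio (s t : Multiset ℕ) (k : ℕ) : ℚ :=
  (s.map fun a => ((a * k)! : ℚ)).prod / (t.map fun a => ((a * k)! : ℚ)).prod

theorem prod_map_factorial_ne_zero (s : Multiset ℕ) (k : ℕ) :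
    (s.map fun a => ((a * k)! : ℚ)).prod ≠ 0 := by
  simp [Multiset.prod_eq_zero_iff, Nat.factorial_ne_zero]

theorem factorialRatio_zero (s t : Multiset ℕ) : factorialRatio s t 0 = 1 := by
  simp [factorialRatio]

theorem prod_map_factorial_mul {p : ℕ} (hp : p ≠ 0) (s : Multiset ℕ) :
    (s.map fun a => ((a * p)! : ℚ)).prod =
      (s.map fun a => (a.uniformBell p : ℚ)).prod * (p ! : ℚ) ^ s.sum *
        (s.map fun a => ((a * 1)! : ℚ)).prod := by
  induction s using Multiset.induction_on with
  | empty => simp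
  | cons a s ih =>
    simp only [Multiset.map_cons, Multiset.prod_cons, Multiset.sum_cons, ih,
      ← Nat.uniformBell_mul_eq a hp, mul_one, pow_add]
    push_cast
    ring

theorem factorialRatio_div_factorialRatio_one {p : ℕ} (hp : p ≠ 0) {s t : Multiset ℕ}
    (hst : s.sum = t.sum) :
    factorialRatio s t p / factorialRatio s t 1 =
      (s.map fun a => (a.uniformBell p : ℚ)).prod /
        (t.map fun a => (a.uniformBell p : ℚ)).prod := by
  have hs := prod_map_factorial_ne_zero s 1
  have ht := prod_map_factorial_ne_zero t 1
  rw [factorialRatio, factorialRatio, prod_map_factorial_mul hp, prod_map_factorial_mul hp, hst]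
  field_simp

theorem prod_map_uniformBell_ratModPow_one {p : ℕ} (hp : p.Prime) (hp3 : 3 < p)
    (s : Multiset ℕ) : RatModPow p 3 (s.map fun a => (a.uniformBell p : ℚ)).prod 1 := by
  have := Fact.mk hp
  refine Multiset.prod_induction (RatModPow p 3 · 1) _ ?_ ?_ ?_
  · exact fun _ _ => RatModPow.mul_congr_one three_ne_zero
  · exact_mod_cast ratModPow_intCast_of_modEq hp.ne_one (Int.ModEq.refl 1)
  · simp only [Multiset.mem_map]
    rintro _ ⟨a, -, rfl⟩
    exact_mod_cast ratModPow_intCast_of_modEq hp.ne_one (uniformBell_prime_modEq_one hp hp3 a)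

theorem factorialRatio_prime_ratModPow {p : ℕ} (hp : p.Prime) (hp3 : 3 < p) {s t : Multiset ℕ}
    (hst : s.sum = t.sum) :
    RatModPow p 3 (factorialRatio s t p / factorialRatio s t 1) 1 := by
  have := Fact.mk hp
  rw [factorialRatio_div_factorialRatio_one hp.ne_zero hst]
  exact (prod_map_uniformBell_ratModPow_one hp hp3 s).div_congr_one three_ne_zero
    (prod_map_uniformBell_ratModPow_one hp hp3 t)

end FactorialRatio

section FermatQuotient

theorem exists_fermatQuotient_eq_intCast {p : ℕ} (hp : p.Prime) {a : ℤ} (ha : ¬ (p : ℤ) ∣ a) :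
    ∃ x : ℤ, fermatQuotient p a = x ∧ (a : ℚ) ^ (p - 1) = 1 + p * x := by
  have hcoprime : IsCoprime a p := ((Prime.coprime_iff_not_dvd
    (Nat.prime_iff_prime_int.mp hp)).mpr ha).symm
  obtain ⟨x, hx⟩ := (Int.ModEq.pow_card_sub_one_eq_one hp hcoprime).symm.dvd
  have hpow : (a : ℚ) ^ (p - 1) - 1 = p * x := by exact_mod_cast hx
  refine ⟨x, ?_, by linear_combination hpow⟩
  rw [fermatQuotient, hpow, mul_div_cancel_left₀ _ (Nat.cast_ne_zero.mpr hp.ne_zero)]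

/-- The second factor is the binomial series of `(1 + q * x) ^ (-i)`, cut off at `q ^ 3 = 0`. -/
theorem one_add_pow_mul_truncated_inverse {R : Type*} [CommRing R] {q : R} (hq : q ^ 3 = 0)
    (x : R) (i : ℕ) :
    (1 + q * x) ^ i * (1 - i * (q * x) + (i + 1).choose 2 * (q * x) ^ 2) = 1 := by
  induction i with
  | zero => simp
  | succ i ih =>
    have hchoose : ((i + 2).choose 2 : R) = (i + 1) + (i + 1).choose 2 := by
      rw [Nat.choose_succ_succ' (i + 1) 1, Nat.choose_one_right]
      push_cast
      ring
    rw [pow_succ, hchoose]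
    push_cast
    linear_combination ih + (1 + q * x) ^ i * ((i + 1) + (i + 1).choose 2) * x ^ 3 * hq

/-- `(2 * q - 1) * (1 + q * x) ^ (-i) * (1 + q * y) ^ (-j)` expanded to second order in `q`, up to
a multiple of `q ^ 3` chosen so as to match the paper; it is used for a prime `q = p` and Fermat
quotients `x`, `y`. -/
def secondOrderExpansion {R : Type*} [CommRing R] (q x y : R) (i j : ℕ) : R :=
  (2 * q - 1) * (1 - q * (i * x + j * y)) -
    q ^ 2 * ((i + 1).choose 2 * x ^ 2 + i * j * x * y + (j + 1).choose 2 * y ^ 2)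

theorem map_secondOrderExpansion {R S : Type*} [CommRing R] [CommRing S] (f : R →+* S)
    (q x y : R) (i j : ℕ) :
    f (secondOrderExpansion q x y i j) = secondOrderExpansion (f q) (f x) (f y) i j := by
  simp [secondOrderExpansion, map_ofNat f 2]

theorem one_add_pow_mul_one_add_pow_mul_secondOrderExpansion {R : Type*} [CommRing R] {q : R}
    (hq : q ^ 3 = 0) (x y : R) (i j : ℕ) :
    (1 + q * x) ^ i * (1 + q * y) ^ j * secondOrderExpansion q x y i j = 2 * q - 1 := by
  have hx := one_add_pow_mul_truncated_inverse hq x i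
  have hy := one_add_pow_mul_truncated_inverse hq y j
  rw [secondOrderExpansion]
  set U := (1 + q * x) ^ i
  set V := (1 + q * y) ^ j
  set A := ((Nat.choose (i + 1) 2 : ℕ) : R)
  set B := ((Nat.choose (j + 1) 2 : ℕ) : R)
  linear_combination (2 * q - 1) * (V * (1 - j * (q * y) + B * (q * y) ^ 2)) * hx +
    (2 * q - 1) * hy - U * V * (2 * (A * x ^ 2 + i * j * x * y + B * y ^ 2) +
      (2 * q - 1) * (A * B * q * x ^ 2 * y ^ 2 - i * B * x * y ^ 2 - j * A * x ^ 2 * y)) * hq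

theorem one_add_pow_mul_one_add_pow_mul_secondOrderExpansion_modEq (q : ℕ) (x y : ℤ) (i j : ℕ) :
    (1 + q * x) ^ i * (1 + q * y) ^ j * secondOrderExpansion (q : ℤ) x y i j ≡ 2 * q - 1
      [ZMOD q ^ 3] := by
  have hq : (q : ZMod (q ^ 3)) ^ 3 = 0 := mod_cast ZMod.natCast_self (q ^ 3)
  have hcast := map_secondOrderExpansion (Int.castRingHom (ZMod (q ^ 3))) (q : ℤ) x y i j
  simp only [eq_intCast, Int.cast_natCast] at hcast
  rw [← Nat.cast_pow, ← ZMod.intCast_eq_intCast_iff]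
  simpa [hcast] using
    one_add_pow_mul_one_add_pow_mul_secondOrderExpansion hq (x : ZMod (q ^ 3)) y i j

theorem ratModPow_pow_pred_mul_secondOrderExpansion {p : ℕ} (hp : p.Prime) {d : ℚ}
    (hpd : ¬ (p : ℤ) ∣ d.num) {a b : ℤ} (ha : ¬ (p : ℤ) ∣ a) (hb : ¬ (p : ℤ) ∣ b) (i j : ℕ) :
    RatModPow p 4
      ((a ^ i * b ^ j / d) ^ (p - 1) *
        (p * secondOrderExpansion (p : ℚ) (fermatQuotient p a) (fermatQuotient p b) i j))
      (p * (d⁻¹ ^ (p - 1) * (2 * p - 1))) := by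
  have := Fact.mk hp
  obtain ⟨x, hx, hax⟩ := exists_fermatQuotient_eq_intCast hp ha
  obtain ⟨y, hy, hby⟩ := exists_fermatQuotient_eq_intCast hp hb
  have hmod := ratModPow_intCast_of_modEq hp.ne_one <|
    one_add_pow_mul_one_add_pow_mul_secondOrderExpansion_modEq p x y i j
  have hcast : ((secondOrderExpansion (p : ℤ) x y i j : ℤ) : ℚ) =
      secondOrderExpansion (p : ℚ) x y i j :=
    map_secondOrderExpansion (Int.castRingHom ℚ) _ _ _ _ _
  have hpow : ((a ^ i * b ^ j / d) ^ (p - 1) : ℚ) =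
      d⁻¹ ^ (p - 1) * ((1 + p * x) ^ i * (1 + p * y) ^ j) := by
    rw [← hax, ← hby, ← pow_mul, ← pow_mul, mul_comm _ i, mul_comm _ j, pow_mul, pow_mul,
      ← mul_pow, ← mul_pow, div_eq_inv_mul]
  have hd : Rat.padicValuation p (d⁻¹ ^ (p - 1)) ≤ 1 := by
    rw [map_pow]
    exact pow_le_one' (padicValuation_inv_le_one hpd) _
  push_cast [hcast] at hmod
  convert! (hmod.mul_left hd).natCast_mul using 1
  rw [hpow, hx, hy]
  ring

end FermatQuotient

section Sums

theorem sum_range_sub_mul_mul_div_pow {K : Type*} [Field K] {M r s : ℕ → K} (hs : s 0 = 0)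
    (hM : ∀ k, s (k + 1) * M (k + 1) = r k * M k) {d : K} (hd : d ≠ 0) (n : ℕ) :
    ∑ k ∈ Finset.range n, (r k - d * s k) * (M k / d ^ k) = s n * M n * (d / d ^ n) := by
  have hterm (k : ℕ) : (r k - d * s k) * (M k / d ^ k) =
      s (k + 1) * M (k + 1) * (d / d ^ (k + 1)) - s k * M k * (d / d ^ k) := by
    rw [hM, pow_succ]
    field_simp
  simp [hterm, Finset.sum_range_sub fun k => s k * M k * (d / d ^ k), hs]

theorem ratModPow_sum_factorialRatio {p : ℕ} (hp : p.Prime) (hp3 : 3 < p) {d : ℚ}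
    (hpd : ¬ (p : ℤ) ∣ d.num) {s t : Multiset ℕ} (hst : s.sum = t.sum) {r : ℕ → ℚ}
    (hr : ∀ k : ℕ, (k + 1) * (2 * k + 1) * factorialRatio s t (k + 1) =
      r k * factorialRatio s t k) :
    RatModPow p 4
      (∑ k ∈ Finset.range p,
        (r k - d * (k * (2 * k - 1))) / r 0 * (factorialRatio s t k / d ^ k))
      (p * (d⁻¹ ^ (p - 1) * (2 * p - 1))) := by
  have := Fact.mk hp
  have hd : d ≠ 0 := by
    rintro rfl
    simp at hpd
  have hr_zero : r 0 = factorialRatio s t 1 := by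
    simpa [factorialRatio_zero] using (hr 0).symm
  have hd_pow : d / d ^ p = d⁻¹ ^ (p - 1) := by
    rw [inv_pow, ← div_mul_cancel_left₀ hd, ← pow_succ', Nat.sub_add_cancel hp.one_le]
  have hsum : ∑ k ∈ Finset.range p,
      (r k - d * (k * (2 * k - 1))) / r 0 * (factorialRatio s t k / d ^ k) =
        p * (d⁻¹ ^ (p - 1) * (2 * p - 1) * (factorialRatio s t p / factorialRatio s t 1)) := by
    have htelescope := sum_range_sub_mul_mul_div_pow (M := factorialRatio s t) (r := r)
      (s := fun k => k * (2 * k - 1)) (by simp) (fun k => by rw [← hr]; push_cast; ring) hd p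
    simp_rw [div_mul_eq_mul_div, ← Finset.sum_div]
    rw [htelescope, hd_pow, hr_zero]
    ring
  have hunit : Rat.padicValuation p (d⁻¹ ^ (p - 1) * (2 * p - 1)) ≤ 1 := by
    have h := Rat.padicValuation_cast p (2 * p - 1) ▸ Int.padicValuation_le_one p (2 * p - 1)
    rw [map_mul, map_pow]
    exact mul_le_one' (pow_le_one' (padicValuation_inv_le_one hpd) _) (mod_cast h)
  rw [hsum]
  simpa using ((factorialRatio_prime_ratModPow hp hp3 hst).mul_left hunit).natCast_mul

theorem ratModPow_sum_factorialRatio_fermatQuotient {p : ℕ} (hp : p.Prime) (hp3 : 3 < p) {d : ℚ}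
    (hpd : ¬ (p : ℤ) ∣ d.num) {s t : Multiset ℕ} (hst : s.sum = t.sum) {r : ℕ → ℚ}
    (hr : ∀ k : ℕ, (k + 1) * (2 * k + 1) * factorialRatio s t (k + 1) =
      r k * factorialRatio s t k)
    {a b : ℤ} (ha : ¬ (p : ℤ) ∣ a) (hb : ¬ (p : ℤ) ∣ b) (i j : ℕ) :
    RatModPow p 4
      (∑ k ∈ Finset.range p,
        (r k - d * (k * (2 * k - 1))) / r 0 * (factorialRatio s t k / d ^ k))
      ((a ^ i * b ^ j / d) ^ (p - 1) *
        (p * secondOrderExpansion (p : ℚ) (fermatQuotient p a) (fermatQuotient p b) i j)) := by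
  have := Fact.mk hp
  exact (ratModPow_sum_factorialRatio hp hp3 hpd hst hr).trans
    (ratModPow_pow_pred_mul_secondOrderExpansion hp hpd ha hb i j).symm

end Sums

section Families

open scoped Nat

theorem choose_two_mul_eq_factorialRatio (k : ℕ) :
    ((2 * k).choose k : ℚ) = factorialRatio {2} {1, 1} k := by
  rw [Nat.cast_choose ℚ (by lia : k ≤ 2 * k), show 2 * k - k = k by lia]
  simp [factorialRatio]

theorem choose_three_mul_eq_factorialRatio (k : ℕ) :
    ((3 * k).choose k : ℚ) = factorialRatio {3} {1, 2} k := by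
  rw [Nat.cast_choose ℚ (by lia : k ≤ 3 * k), show 3 * k - k = 2 * k by lia]
  simp [factorialRatio]

theorem choose_four_mul_eq_factorialRatio (k : ℕ) :
    ((4 * k).choose (2 * k) : ℚ) = factorialRatio {4} {2, 2} k := by
  rw [Nat.cast_choose ℚ (by lia : 2 * k ≤ 4 * k), show 4 * k - 2 * k = 2 * k by lia]
  simp [factorialRatio]

theorem choose_six_mul_eq_factorialRatio (k : ℕ) :
    ((3 * k).choose k : ℚ) * (6 * k).choose (3 * k) / (2 * k).choose k =
      factorialRatio {6, 1} {3, 2, 2} k := by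
  rw [Nat.cast_choose ℚ (by lia : k ≤ 3 * k), Nat.cast_choose ℚ (by lia : k ≤ 2 * k),
    Nat.cast_choose ℚ (by lia : 3 * k ≤ 6 * k), show 3 * k - k = 2 * k by lia,
    show 6 * k - 3 * k = 3 * k by lia, show 2 * k - k = k by lia]
  simp only [factorialRatio, Multiset.insert_eq_cons, Multiset.map_cons, Multiset.map_singleton,
    Multiset.prod_cons, Multiset.prod_singleton, one_mul]
  field_simp

theorem factorialRatio_two_succ (k : ℕ) :
    (k + 1) * (2 * k + 1) * factorialRatio {2} {1, 1} (k + 1) =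
      2 * (2 * k + 1) ^ 2 * factorialRatio {2} {1, 1} k := by
  simp only [factorialRatio, Multiset.insert_eq_cons, Multiset.map_cons, Multiset.map_singleton,
    Multiset.prod_cons, Multiset.prod_singleton, mul_add, mul_one, Nat.factorial_succ]
  push_cast
  field_simp
  ring

theorem factorialRatio_three_succ (k : ℕ) :
    (k + 1) * (2 * k + 1) * factorialRatio {3} {1, 2} (k + 1) =
      3 / 2 * (3 * k + 1) * (3 * k + 2) * factorialRatio {3} {1, 2} k := by
  simp only [factorialRatio, Multiset.insert_eq_cons, Multiset.map_cons, Multiset.map_singleton,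
    Multiset.prod_cons, Multiset.prod_singleton, mul_add, mul_one, Nat.factorial_succ]
  push_cast
  field_simp
  ring

theorem factorialRatio_four_succ (k : ℕ) :
    (k + 1) * (2 * k + 1) * factorialRatio {4} {2, 2} (k + 1) =
      2 * (4 * k + 1) * (4 * k + 3) * factorialRatio {4} {2, 2} k := by
  simp only [factorialRatio, Multiset.insert_eq_cons, Multiset.map_cons, Multiset.map_singleton,
    Multiset.prod_cons, Multiset.prod_singleton, mul_add, mul_one, Nat.factorial_succ]
  push_cast
  field_simp
  ring

theorem factorialRatio_six_succ (k : ℕ) :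
    (k + 1) * (2 * k + 1) * factorialRatio {6, 1} {3, 2, 2} (k + 1) =
      6 * (6 * k + 1) * (6 * k + 5) * factorialRatio {6, 1} {3, 2, 2} k := by
  simp only [factorialRatio, Multiset.insert_eq_cons, Multiset.map_cons, Multiset.map_singleton,
    Multiset.prod_cons, Multiset.prod_singleton, mul_add, mul_one, Nat.factorial_succ]
  push_cast
  field_simp
  ring

end Families

theorem corollary1p2 (p : ℕ) (hp : p.Prime) (hp3 : 3 < p)
    (d : ℚ) (hd : d ≠ 0) (hpd : ¬ (p : ℤ) ∣ d.num) :
    RatModPow p 4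
      (∑ k ∈ Finset.range p,
        (1 + (4 - d) * (k : ℚ) ^ 2 + (8 + d) / 2 * (k : ℚ)) *
          (((2 * k).choose k : ℚ) / d ^ k))
      ((16 / d) ^ (p - 1) *
        ((p : ℚ) * (2 * (p : ℚ) - 1) * (1 - 4 * (p : ℚ) * fermatQuotient p 2)
          - 10 * (p : ℚ) ^ 3 * fermatQuotient p 2 ^ 2)) ∧
    RatModPow p 4
      (∑ k ∈ Finset.range p,
        (1 + (27 - 4 * d) / 6 * (k : ℚ) ^ 2 + (27 + 2 * d) / 6 * (k : ℚ)) *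
          (((3 * k).choose k : ℚ) / d ^ k))
      ((-(27 / d)) ^ (p - 1) * (p : ℚ) *
        ((2 * (p : ℚ) - 1) * (1 - 3 * (p : ℚ) * fermatQuotient p 3)
          - 6 * (p : ℚ) ^ 2 * fermatQuotient p 3 ^ 2)) ∧
    RatModPow p 4
      (∑ k ∈ Finset.range p,
        (1 + (16 - d) / 3 * (k : ℚ) ^ 2 + (32 + d) / 6 * (k : ℚ)) *
          (((4 * k).choose (2 * k) : ℚ) / d ^ k))
      ((-(64 / d)) ^ (p - 1) * (p : ℚ) *
        ((2 * (p : ℚ) - 1) * (1 - 6 * (p : ℚ) * fermatQuotient p 2)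
          - 21 * (p : ℚ) ^ 2 * fermatQuotient p 2 ^ 2)) ∧
    RatModPow p 4
      (∑ k ∈ Finset.range p,
        (1 + (108 - d) / 15 * (k : ℚ) ^ 2 + (216 + d) / 30 * (k : ℚ)) *
          (((3 * k).choose k : ℚ) * ((6 * k).choose (3 * k) : ℚ) /
            (d ^ k * ((2 * k).choose k : ℚ))))
      ((-(432 / d)) ^ (p - 1) * (p : ℚ) *
        ((2 * (p : ℚ) - 1) *
            (1 - 4 * (p : ℚ) * fermatQuotient p 2 - 3 * (p : ℚ) * fermatQuotient p 3)
          - 2 * (p : ℚ) ^ 2 *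
            (5 * fermatQuotient p 2 ^ 2 + 6 * fermatQuotient p 2 * fermatQuotient p 3
              + 3 * fermatQuotient p 3 ^ 2))) := by
  have h2 : ¬ (p : ℤ) ∣ 2 := by exact_mod_cast Nat.not_dvd_of_pos_of_lt two_pos (by lia)
  have h3 : ¬ (p : ℤ) ∣ 3 := by exact_mod_cast Nat.not_dvd_of_pos_of_lt three_pos hp3
  have hneg (x : ℚ) : (-x) ^ (p - 1) = x ^ (p - 1) := (hp.even_sub_one (by lia)).neg_pow x
  have key {s t : Multiset ℕ} {r : ℕ → ℚ} (hr) (hst) :=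
    ratModPow_sum_factorialRatio_fermatQuotient (s := s) (t := t) (r := r) hp hp3 hpd hst hr h2 h3
  simp only [hneg]
  refine ⟨?_, ?_, ?_, ?_⟩
  · convert! key factorialRatio_two_succ rfl 4 0 using 1
    · exact Finset.sum_congr rfl fun k _ => by rw [choose_two_mul_eq_factorialRatio]; ring
    · norm_num only [secondOrderExpansion, Nat.choose]
      ring
  · convert! key factorialRatio_three_succ rfl 0 3 using 1
    · exact Finset.sum_congr rfl fun k _ => by rw [choose_three_mul_eq_factorialRatio]; ring
    · norm_num only [secondOrderExpansion, Nat.choose]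
      ring
  · convert! key factorialRatio_four_succ rfl 6 0 using 1
    · exact Finset.sum_congr rfl fun k _ => by rw [choose_four_mul_eq_factorialRatio]; ring
    · norm_num only [secondOrderExpansion, Nat.choose]
      ring
  · convert! key factorialRatio_six_succ rfl 4 3 using 1
    · exact Finset.sum_congr rfl fun k _ => by rw [← choose_six_mul_eq_factorialRatio]; ring
    · norm_num only [secondOrderExpansion, Nat.choose]
      ring
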